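/- Let $r\ge 1$ and $n\ge 0$ be integers, and let $z_0,z_1,\dots,z_n$ be commuting indeterminates. Write $[m]_q:=1+q+\cdots+q^{m-1}$. The wreath product $\mathbb{Z}_r\wr S_n$ consists of the pairs $(\pi,\epsilon)$ with $\pi\in S_n$ and $\epsilon=(\omega^{c_1},\dots,\omega^{c_n})$, where $\omega=e^{2\pi i/r}$ and $c_j\in\{0,\dots,r-1\}$. Put $c_{n+1}:=0$; for $1\le j\le n$ let $a_j^\epsilon\in\{0,\dots,r-1\}$ be the residue of $c_j-c_{j+1}$ modulo $r$, and let $\mathrm{ch}(\epsilon):=\sum_{j=1}^n a_j^\epsilon$. Let $\mathrm{Des}(\pi):=\{j\in\{1,\dots,n-1\}:\pi(j)>\pi(j+1)\}$. Then, as formal power series in $z_0,\dots,z_n$ (with coefficients in any commutative ring), $$\sum_{k\ge0}\ \prod_{j=1}^n[rk+1]_{z_j}\,z_0^k\;=\;\sum_{(\pi,\epsilon)\in\mathbb{Z}_r\wr S_n}\frac{\displaystyle z_0^{\lceil \mathrm{ch}(\epsilon)/r\rceil}\ \prod_{j=1}^n\bigl(z_{\pi(1)}z_{\pi(2)}\cdots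 z_{\pi(j)}\bigr)^{a_j^\epsilon}\ \prod_{\substack{j\in\mathrm{Des}(\pi)\\ a_j^\epsilon=0}}z_0\,z_{\pi(1)}^r z_{\pi(2)}^r\cdots z_{\pi(j)}^r}{\displaystyle\prod_{j=0}^n\bigl(1-z_0\,z_{\pi(1)}^r z_{\pi(2)}^r\cdots z_{\pi(j)}^r\bigr)}.$$ -/

import Mathlib

open scoped MvPowerSeries.WithPiTopology

/-- The `q`-integer `[m]_q = 1 + q + ⋯ + q ^ (m - 1)`. -/
def qInt {A : Type*} [CommRing A] (m : ℕ) (q : A) : A :=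
  ∑ i ∈ Finset.range m, q ^ i

/-- The set of descents of a permutation of `n` letters. Positions are written from `0`, so that
`j : Fin n` stands for the position `j + 1`, and it is a descent if `π (j) > π (j + 1)`; the last
position is never a descent. -/
def permDes {n : ℕ} (π : Equiv.Perm (Fin n)) : Finset (Fin n) :=
  Finset.univ.filter fun j => ∃ h : (j : ℕ) + 1 < n, π ⟨(j : ℕ) + 1, h⟩ < π j

/-- An element `(π, ε)` of the wreath product of the cyclic group of order `r` with the symmetric
group on `n` letters (a colored permutation). The vector `ε = (ω ^ c₁, …, ω ^ cₙ)`, where `ω` is a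
primitive `r`-th root of unity, is recorded by its exponents `c`, residues modulo `r`. -/
@[ext]
structure ColoredPerm (r n : ℕ) where
  perm : Equiv.Perm (Fin n)
  color : Fin n → ZMod r

namespace ColoredPerm

variable {r n : ℕ}

/-- The group law: multiplication of the monomial matrices whose entry at `(π i, i)` is
`ω ^ c i` and whose other entries are `0`. -/
instance : Group (ColoredPerm r n) where
  mul g h := ⟨g.perm * h.perm, fun i => g.color (h.perm i) + h.color i⟩
  one := ⟨1, 0⟩
  inv g := ⟨g.perm⁻¹, fun i => -g.color (g.perm⁻¹ i)⟩
  mul_assoc a b c := by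
    refine ColoredPerm.ext (mul_assoc a.perm b.perm c.perm) (funext fun i => ?_)
    exact add_assoc (a.color (b.perm (c.perm i))) (b.color (c.perm i)) (c.color i)
  one_mul a := ColoredPerm.ext (one_mul a.perm) (funext fun i => zero_add (a.color i))
  mul_one a := ColoredPerm.ext (mul_one a.perm) (funext fun i => add_zero (a.color i))
  inv_mul_cancel a := by
    refine ColoredPerm.ext (inv_mul_cancel a.perm) (funext fun i => ?_)
    change -a.color (a.perm⁻¹ (a.perm i)) + a.color i = 0
    simp

/-- A colored permutation as a pair. -/
def equivProd (r n : ℕ) : ColoredPerm r n ≃ Equiv.Perm (Fin n) × (Fin n → ZMod r) where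
  toFun g := (g.perm, g.color)
  invFun p := ⟨p.1, p.2⟩
  left_inv _ := rfl
  right_inv _ := rfl

instance [NeZero r] : Fintype (ColoredPerm r n) :=
  Fintype.ofEquiv _ (equivProd r n).symm

/-- The color exponent at a position (written from `0`), with the convention that
`ε` is continued by `1 = ω ^ 0` after its last entry. -/
def colorExt (g : ColoredPerm r n) (m : ℕ) : ZMod r :=
  if h : m < n then g.color ⟨m, h⟩ else 0

/-- The color change `a_j = (c_j - c_{j+1}) mod r`, a number in `{0, …, r - 1}`. -/
def colorChange (g : ColoredPerm r n) (j : Fin n) : ℕ :=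
  (g.colorExt j - g.colorExt ((j : ℕ) + 1)).val

/-- The total color change `ch(ε) = ∑ j, a_j`. -/
def totalChange (g : ColoredPerm r n) : ℕ :=
  ∑ j, g.colorChange j

end ColoredPerm

namespace ColoredPerm

variable {r n : ℕ} (R : Type*) [CommRing R]

/-- The monomial `z_{π(1)} z_{π(2)} ⋯ z_{π(m)}` as a formal power series in `z_0, …, z_n`.
The letter `i : Fin n` of `π` belongs to the variable with index `i.succ`. -/
noncomputable def prefixProd (g : ColoredPerm r n) (m : ℕ) : MvPowerSeries (Fin (n + 1)) R :=
  ∏ i ∈ Finset.univ.filter (fun i : Fin n => (i : ℕ) < m), MvPowerSeries.X (g.perm i).succ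

/-- The numerator of the summand of `(π, ε)`; the position `j + 1` is written as `j : Fin n`. -/
noncomputable def numer (g : ColoredPerm r n) : MvPowerSeries (Fin (n + 1)) R :=
  MvPowerSeries.X 0 ^ ⌈(g.totalChange : ℚ) / (r : ℚ)⌉₊ *
    (∏ j : Fin n, g.prefixProd R ((j : ℕ) + 1) ^ g.colorChange j) *
    ∏ j ∈ (permDes g.perm).filter (fun j => g.colorChange j = 0),
      (MvPowerSeries.X 0 * g.prefixProd R ((j : ℕ) + 1) ^ r)

/-- The denominator of the summand of `(π, ε)`, a product over `j = 0, …, n`. -/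
noncomputable def denom (g : ColoredPerm r n) : MvPowerSeries (Fin (n + 1)) R :=
  ∏ j ∈ Finset.range (n + 1), (1 - MvPowerSeries.X 0 * g.prefixProd R j ^ r)

end ColoredPerm

/-!
Both sides are the generating function of the set of `(k, x)` in `ℕ × ℕ ^ n` with `x_i ≤ r * k` for
all `i`, where `k` is the exponent of `z_0` and `x_i` that of `z_i`.

On the left, `∏ j, [rk + 1]_{z_j}` enumerates the points of the cube `{0, …, rk} ^ n`
(`prod_qInt_mul_X_pow`), and the sum over `k` collects the slices
(`hasSum_indicatorSeries_slices`).

On the right, the summand of `(π, ε)` enumerates the points whose exponent vector is that of the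
numerator plus a combination of the rays `z_0 (z_{π(1)} ⋯ z_{π(j)}) ^ r` with coefficients in `ℕ`;
these combinations are pairwise distinct, so the quotient is exactly the generating function of that
set (`indicatorSeries_range_mul_prod`). The differences `x_{π(j)} - x_{π(j+1)}`, with
`x_{π(n+1)} = 0`, of such a point are congruent to `a_j` modulo `r`, and they are positive at the
descents of `π`, either because `a_j > 0` or because of the extra factor in the numerator. Hence the
set consists of those `(k, x)` in the cone for which `π` is the stable sort of `x` into weakly
decreasing order and `c_j` is the residue of `x_{π(j)}` modulo `r`
(`ColoredPerm.mem_range_coneExp_iff`). The exponent `⌈ch(ε) / r⌉` of `z_0` is the least one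
compatible with `x_{π(1)} ≤ r * k`. Every point determines `π` and `ε`, so these sets partition the
cone.
-/

/-! ### Generating functions of free monoid orbits -/

section IndicatorSeries

variable {σ : Type*} (R : Type*) [CommRing R]

open Classical in
/-- The generating function `∑ s ∈ A, X ^ s` of a set `A` of exponent vectors. -/
noncomputable def indicatorSeries (A : Set (σ →₀ ℕ)) : MvPowerSeries σ R :=
  fun s => if s ∈ A then 1 else 0

open Classical in
theorem coeff_indicatorSeries (A : Set (σ →₀ ℕ)) (s : σ →₀ ℕ) :
    MvPowerSeries.coeff s (indicatorSeries R A) = if s ∈ A then 1 else 0 := rfl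

theorem indicatorSeries_singleton (b : σ →₀ ℕ) :
    indicatorSeries R {b} = MvPowerSeries.monomial b 1 := by
  classical
  ext s
  simp [coeff_indicatorSeries, MvPowerSeries.coeff_monomial]

/-- Multiplication by `1 - X ^ v` removes the translate `A + v` from a set `A` that contains it. -/
theorem indicatorSeries_mul_one_sub_monomial {A B : Set (σ →₀ ℕ)} {v : σ →₀ ℕ}
    (hA : ∀ s ∈ A, s + v ∈ A) (hB : ∀ s, s ∈ B ↔ s ∈ A ∧ ∀ t ∈ A, t + v ≠ s) :
    indicatorSeries R A * (1 - MvPowerSeries.monomial v 1) = indicatorSeries R B := by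
  classical
  ext s
  rw [mul_sub, mul_one, map_sub, MvPowerSeries.coeff_mul_monomial]
  simp only [coeff_indicatorSeries, mul_one, hB]
  by_cases hv : v ≤ s
  · obtain ⟨t, rfl⟩ := exists_add_of_le hv
    rw [if_pos hv, add_tsub_cancel_left, add_comm v t]
    by_cases ht : t ∈ A
    · have : ¬ (t + v ∈ A ∧ ∀ u ∈ A, u + v ≠ t + v) := fun h => h.2 t ht rfl
      rw [if_pos (hA t ht), if_pos ht, if_neg this, sub_self]
    · have : (∀ u ∈ A, u + v ≠ t + v) := fun u hu h => ht (add_right_cancel h ▸ hu)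
      simp only [if_neg ht, and_iff_left this, sub_zero]
  · have : ∀ t ∈ A, t + v ≠ s := fun t _ h => hv (h ▸ le_add_self)
    simp only [if_neg hv, and_iff_left this, sub_zero]

/-- If the exponent vectors `b + ∑ j, m j • v j` are pairwise distinct, then their generating
function is `X ^ b / ∏ j, (1 - X ^ v j)`. -/
theorem indicatorSeries_range_mul_prod {ι : Type*} [Fintype ι] (b : σ →₀ ℕ) (v : ι → σ →₀ ℕ)
    (hinj : Function.Injective fun m : ι → ℕ => b + ∑ j, m j • v j) :
    indicatorSeries R (Set.range fun m : ι → ℕ => b + ∑ j, m j • v j) *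
      ∏ j, (1 - MvPowerSeries.monomial (v j) 1) = MvPowerSeries.monomial b 1 := by
  classical
  set φ : (ι → ℕ) → σ →₀ ℕ := fun m => b + ∑ j, m j • v j with hφ
  have hstep (m : ι → ℕ) (i : ι) : φ (m + Pi.single i 1) = φ m + v i := by
    simp only [hφ, Pi.add_apply, add_smul, Finset.sum_add_distrib, add_assoc]
    congr 2
    rw [Finset.sum_eq_single i] <;> simp +contextual
  have key (J : Finset ι) :
      indicatorSeries R (φ '' {m | ∀ j ∉ J, m j = 0}) *
        ∏ j ∈ J, (1 - MvPowerSeries.monomial (v j) 1) = MvPowerSeries.monomial b 1 := by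
    induction J using Finset.induction_on with
    | empty =>
      have : {m : ι → ℕ | ∀ j ∉ (∅ : Finset ι), m j = 0} = {0} := by
        ext m
        simp [funext_iff]
      rw [this, Set.image_singleton, indicatorSeries_singleton]
      simp [hφ]
    | insert i J hi ih =>
      rw [Finset.prod_insert hi, ← mul_assoc, ← ih]
      congr 1
      apply indicatorSeries_mul_one_sub_monomial
      · rintro _ ⟨m, hm, rfl⟩
        refine ⟨m + Pi.single i 1, fun j hj => ?_, hstep m i⟩
        have hji : j ≠ i := fun h => hj (h ▸ Finset.mem_insert_self i J)
        simp [hm j hj, hji]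
      · intro s
        constructor
        · rintro ⟨m, hm, rfl⟩
          refine ⟨⟨m, fun j hj => hm j fun h => hj (Finset.mem_insert_of_mem h), rfl⟩, ?_⟩
          rintro _ ⟨m', -, rfl⟩ h
          rw [← hstep] at h
          have := congrFun (hinj h) i
          simp [hm i hi] at this
        · rintro ⟨⟨m, hm, rfl⟩, h⟩
          refine ⟨m, fun j hj => ?_, rfl⟩
          by_cases hji : j = i
          · subst hji
            by_contra h0
            have hsub : m - Pi.single j 1 + Pi.single j 1 = m := by
              ext k
              by_cases hk : k = j
              · subst hk; simp; omega
              · simp [hk]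
            refine h _ ⟨m - Pi.single j 1, fun k hk => ?_, rfl⟩ (by rw [← hstep, hsub])
            simp [hm k hk]
          · exact hm j (by simp [hj, hji])
  simpa using key Finset.univ

theorem prod_monomial_one {ι : Type*} (s : Finset ι) (v : ι → σ →₀ ℕ) :
    ∏ i ∈ s, MvPowerSeries.monomial (v i) (1 : R) = MvPowerSeries.monomial (∑ i ∈ s, v i) 1 := by
  classical
  induction s using Finset.induction_on with
  | empty => simp
  | insert i s hi ih =>
    rw [Finset.prod_insert hi, Finset.sum_insert hi, ih, MvPowerSeries.monomial_mul_monomial,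
      one_mul]

theorem monomial_one_pow (v : σ →₀ ℕ) (k : ℕ) :
    MvPowerSeries.monomial v (1 : R) ^ k = MvPowerSeries.monomial (k • v) 1 := by
  simpa using prod_monomial_one R (Finset.range k) fun _ => v

end IndicatorSeries

/-! ### Cubes of lattice points -/

/-- Summing, over `k`, the generating functions of the slices `s 0 = k` of a set of exponent
vectors gives the generating function of the whole set, whatever the topology of `R`. -/
theorem hasSum_indicatorSeries_slices {σ R : Type*} [CommRing R] [TopologicalSpace R]
    (A : Set (σ →₀ ℕ)) (i : σ) :
    HasSum (fun k : ℕ => indicatorSeries R {s | s ∈ A ∧ s i = k}) (indicatorSeries R A) := by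
  classical
  refine Pi.hasSum.2 fun s => ?_
  have h := hasSum_single (f := fun k : ℕ => indicatorSeries R {s | s ∈ A ∧ s i = k} s) (s i)
    (fun k hk => by simp [indicatorSeries, Ne.symm hk])
  simpa [indicatorSeries] using h

theorem prod_qInt_mul_X_pow (n N k : ℕ) (R : Type*) [CommRing R] :
    (∏ j : Fin n, qInt (N + 1) (MvPowerSeries.X j.succ : MvPowerSeries (Fin (n + 1)) R)) *
      MvPowerSeries.X 0 ^ k =
    indicatorSeries R {s : Fin (n + 1) →₀ ℕ | (∀ j : Fin n, s j.succ ≤ N) ∧ s 0 = k} := by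
  classical
  simp only [qInt, Finset.prod_univ_sum, Finset.sum_mul, MvPowerSeries.X_pow_eq,
    prod_monomial_one, MvPowerSeries.monomial_mul_monomial, mul_one]
  have hval (p : Fin n → ℕ) : (∑ j, Finsupp.single j.succ (p j)) + Finsupp.single 0 k =
      Finsupp.equivFunOnFinite.symm (Fin.cons k p : Fin (n + 1) → ℕ) := by
    ext i
    refine Fin.cases ?_ (fun i => ?_) i
    · simp [Fin.succ_ne_zero]
    · simp [Finsupp.single_apply]
  ext s
  simp only [map_sum, MvPowerSeries.coeff_monomial, hval, coeff_indicatorSeries,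
    Set.mem_ofPred_eq]
  have hs (p : Fin n → ℕ) : s = Finsupp.equivFunOnFinite.symm (Fin.cons k p : Fin (n + 1) → ℕ) ↔
      s 0 = k ∧ (fun j => s (Fin.succ j)) = p := by
    rw [Finsupp.ext_iff, Fin.forall_fin_succ, funext_iff]
    simp
  simp only [hs]
  by_cases h0 : s 0 = k
  · simp [h0, Fintype.mem_piFinset]
  · simp [h0]

/-! ### Stable sorting -/

/-- A permutation is the stable sort of `f` if and only if `f ∘ π` is weakly increasing and
strictly increases at the descents of `π`; it is enough to compare neighbours. -/
theorem eq_sort_iff_forall_succ {n : ℕ} {α : Type*} [LinearOrder α] {f : Fin n → α}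
    {π : Equiv.Perm (Fin n)} :
    π = Tuple.sort f ↔ ∀ (j : Fin n) (h : (j : ℕ) + 1 < n),
      f (π j) ≤ f (π ⟨(j : ℕ) + 1, h⟩) ∧
        (π ⟨(j : ℕ) + 1, h⟩ < π j → f (π j) < f (π ⟨(j : ℕ) + 1, h⟩)) := by
  rw [Tuple.eq_sort_iff']
  cases n with
  | zero => exact ⟨fun _ j => j.elim0, fun _ j => j.elim0⟩
  | succ n =>
    rw [Fin.strictMono_iff_lt_succ]
    have hlt (a b : Fin (n + 1)) : Tuple.graphEquiv₁ f a < Tuple.graphEquiv₁ f b ↔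
        f a < f b ∨ f a = f b ∧ a < b := Prod.Lex.toLex_lt_toLex
    have hne (i : Fin n) : π i.castSucc ≠ π i.succ :=
      fun h => (Fin.castSucc_lt_succ (i := i)).ne (π.injective h)
    simp only [Equiv.trans_apply, hlt]
    constructor
    · intro H j h
      have hj := H ⟨j, by omega⟩
      change f (π j) < f (π ⟨(j : ℕ) + 1, h⟩) ∨ f (π j) = f (π ⟨(j : ℕ) + 1, h⟩) ∧
        π j < π ⟨(j : ℕ) + 1, h⟩ at hj
      rcases hj with hj | ⟨hj, hj'⟩
      · exact ⟨hj.le, fun _ => hj⟩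
      · exact ⟨hj.le, fun h' => absurd h' hj'.asymm⟩
    · intro H i
      have hi := H i.castSucc (by simp)
      change f (π i.castSucc) ≤ f (π i.succ) ∧
        (π i.succ < π i.castSucc → f (π i.castSucc) < f (π i.succ)) at hi
      rcases hi.1.lt_or_eq with h | h
      · exact Or.inl h
      · refine Or.inr ⟨h, lt_of_le_of_ne (le_of_not_gt fun h' => (hi.2 h').ne h) (hne i)⟩

namespace ColoredPerm

variable {r n : ℕ}

/-! ### Exponent vectors of numerator and denominator -/

/-- The exponent vector of `z_{π(1)} ⋯ z_{π(m)}`. -/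
noncomputable def prefixExp (g : ColoredPerm r n) (m : ℕ) : Fin (n + 1) →₀ ℕ :=
  ∑ i ∈ Finset.univ.filter (fun i : Fin n => (i : ℕ) < m), Finsupp.single (g.perm i).succ 1

/-- The exponent vector of `z_0 (z_{π(1)} ⋯ z_{π(m)}) ^ r`. -/
noncomputable def rayExp (g : ColoredPerm r n) (m : ℕ) : Fin (n + 1) →₀ ℕ :=
  Finsupp.single 0 1 + r • g.prefixExp m

/-- The exponent vector of the numerator of the summand of `(π, ε)`. -/
noncomputable def numerExp (g : ColoredPerm r n) : Fin (n + 1) →₀ ℕ :=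
  Finsupp.single 0 ⌈(g.totalChange : ℚ) / (r : ℚ)⌉₊ +
    ∑ j : Fin n, g.colorChange j • g.prefixExp ((j : ℕ) + 1) +
    ∑ j ∈ (permDes g.perm).filter (fun j => g.colorChange j = 0), g.rayExp ((j : ℕ) + 1)

/-- The exponent vector obtained from the numerator of `(π, ε)` by multiplying with the `m j`-th
power of the `j`-th ray, for `j = 0, …, n`. -/
noncomputable def coneExp (g : ColoredPerm r n) (m : Fin (n + 1) → ℕ) : Fin (n + 1) →₀ ℕ :=
  g.numerExp + ∑ j : Fin (n + 1), m j • g.rayExp j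

/-- `1` at the descents of `π` at which the color does not change, and `0` elsewhere. -/
def monoDes (g : ColoredPerm r n) (j : Fin n) : ℕ :=
  if j ∈ permDes g.perm ∧ g.colorChange j = 0 then 1 else 0

section Series

variable (R : Type*) [CommRing R]

theorem prefixProd_eq_monomial (g : ColoredPerm r n) (m : ℕ) :
    g.prefixProd R m = MvPowerSeries.monomial (g.prefixExp m) 1 := by
  simp only [prefixProd, MvPowerSeries.X_def, prod_monomial_one, prefixExp]

theorem X_mul_prefixProd_pow_eq_monomial (g : ColoredPerm r n) (m : ℕ) :
    MvPowerSeries.X 0 * g.prefixProd R m ^ r = MvPowerSeries.monomial (g.rayExp m) 1 := by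
  rw [prefixProd_eq_monomial, monomial_one_pow, MvPowerSeries.X_def,
    MvPowerSeries.monomial_mul_monomial, one_mul, rayExp]

theorem numer_eq_monomial (g : ColoredPerm r n) :
    g.numer R = MvPowerSeries.monomial g.numerExp 1 := by
  simp only [numer, X_mul_prefixProd_pow_eq_monomial]
  simp only [prefixProd_eq_monomial, monomial_one_pow, MvPowerSeries.X_pow_eq, prod_monomial_one,
    MvPowerSeries.monomial_mul_monomial, one_mul, numerExp]

theorem denom_eq_prod (g : ColoredPerm r n) :
    g.denom R = ∏ j : Fin (n + 1), (1 - MvPowerSeries.monomial (g.rayExp j) 1) := by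
  simp only [denom, X_mul_prefixProd_pow_eq_monomial, Finset.prod_range]

theorem isUnit_denom (g : ColoredPerm r n) : IsUnit (g.denom R) := by
  rw [MvPowerSeries.isUnit_iff_constantCoeff, denom, map_prod]
  simp

end Series

/-! ### Coordinates on the cone of a colored permutation -/

@[simp]
theorem prefixExp_zero (g : ColoredPerm r n) (m : ℕ) : g.prefixExp m 0 = 0 := by
  simp [prefixExp, Finsupp.finsetSum_apply, Fin.succ_ne_zero]

@[simp]
theorem prefixExp_succ (g : ColoredPerm r n) (m : ℕ) (i : Fin n) :
    g.prefixExp m (g.perm i).succ = if (i : ℕ) < m then 1 else 0 := by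
  simp [prefixExp, Finsupp.finsetSum_apply, Finsupp.single_apply, Finset.sum_ite_eq']

@[simp]
theorem rayExp_zero (g : ColoredPerm r n) (m : ℕ) : g.rayExp m 0 = 1 := by
  simp [rayExp]

@[simp]
theorem rayExp_succ (g : ColoredPerm r n) (m : ℕ) (i : Fin n) :
    g.rayExp m (g.perm i).succ = if (i : ℕ) < m then r else 0 := by
  simp [rayExp]

theorem coneExp_zero (g : ColoredPerm r n) (m : Fin (n + 1) → ℕ) :
    g.coneExp m 0 = m 0 + ⌈(g.totalChange : ℚ) / (r : ℚ)⌉₊ +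
      ∑ j : Fin n, (g.monoDes j + m j.succ) := by
  simp only [coneExp, numerExp, Finsupp.add_apply, Finsupp.finsetSum_apply, Finsupp.smul_apply,
    rayExp_zero, prefixExp_zero, Finsupp.single_eq_same, Fin.sum_univ_succ, smul_eq_mul, mul_zero,
    mul_one, Finset.sum_const_zero, Finset.sum_add_distrib, monoDes]
  simp only [permDes, Finset.filter_filter, Finset.sum_filter, Finset.mem_filter, Finset.mem_univ,
    true_and]
  ring

theorem coneExp_succ (g : ColoredPerm r n) (m : Fin (n + 1) → ℕ) (i : Fin n) :
    g.coneExp m (g.perm i).succ = ∑ j : Fin n, if (i : ℕ) ≤ j then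
      g.colorChange j + r * (g.monoDes j + m j.succ) else 0 := by
  simp only [coneExp, numerExp, Finsupp.add_apply, Finsupp.finsetSum_apply, Finsupp.smul_apply,
    rayExp_succ, prefixExp_succ, Fin.sum_univ_succ, smul_eq_mul, Fin.val_succ, Fin.val_zero,
    Nat.not_lt_zero, if_false, mul_zero, zero_add, Nat.lt_succ_iff,
    Finsupp.single_eq_of_ne (Fin.succ_ne_zero _)]
  simp only [permDes, Finset.filter_filter, Finset.sum_filter, ← Finset.sum_add_distrib, monoDes,
    Finset.mem_filter, Finset.mem_univ, true_and]
  refine Finset.sum_congr rfl fun j _ => ?_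
  split_ifs <;> ring

/-- The coordinates of `s` in the order `π(1), …, π(n)`, continued by `0`. -/
def sortedCoord (g : ColoredPerm r n) (s : Fin (n + 1) →₀ ℕ) (k : ℕ) : ℕ :=
  if h : k < n then s (g.perm ⟨k, h⟩).succ else 0

theorem sortedCoord_of_lt (g : ColoredPerm r n) (s : Fin (n + 1) →₀ ℕ) (j : Fin n) :
    g.sortedCoord s j = s (g.perm j).succ := by
  simp [sortedCoord]

theorem sortedCoord_of_le (g : ColoredPerm r n) (s : Fin (n + 1) →₀ ℕ) {k : ℕ} (h : n ≤ k) :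
    g.sortedCoord s k = 0 := by
  simp [sortedCoord, h]

end ColoredPerm

/-- A sequence that vanishes from `n` on consists of the tail sums of its differences. -/
theorem eq_sum_tail_iff {n : ℕ} (y : ℕ → ℕ) (d : Fin n → ℕ) (hy : y n = 0) :
    (∀ k ≤ n, y k = ∑ j : Fin n, if k ≤ (j : ℕ) then d j else 0) ↔
      ∀ j : Fin n, y j = y ((j : ℕ) + 1) + d j := by
  have hstep (i : Fin n) : (∑ j : Fin n, if (i : ℕ) ≤ (j : ℕ) then d j else 0) =
      (∑ j : Fin n, if (i : ℕ) + 1 ≤ (j : ℕ) then d j else 0) + d i := by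
    have hi : d i = ∑ j : Fin n, if i = j then d j else 0 := by simp
    conv_rhs => rw [hi, ← Finset.sum_add_distrib]
    refine Finset.sum_congr rfl fun j _ => ?_
    rcases lt_trichotomy i j with h | h | h
    · have h' : (i : ℕ) < j := h
      simp [h'.le, h.ne, Nat.succ_le_of_lt h']
    · simp [h]
    · have h' : (j : ℕ) < i := h
      simp [h.ne', h'.not_ge, show ¬ ((i : ℕ) + 1 ≤ j) by omega]
  constructor
  · intro H j
    rw [H j j.2.le, H _ j.2, hstep]
  · intro H k hk
    induction hk using Nat.decreasingInduction with
    | self =>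
      rw [hy]
      exact (Finset.sum_eq_zero fun j _ => if_neg (by omega)).symm
    | of_succ k hk ih => rw [H ⟨k, hk⟩, ih, ← hstep ⟨k, hk⟩]

namespace ColoredPerm

variable {r n : ℕ}

theorem eq_coneExp_iff (g : ColoredPerm r n) (s : Fin (n + 1) →₀ ℕ) (m : Fin (n + 1) → ℕ) :
    s = g.coneExp m ↔
      s 0 = m 0 + ⌈(g.totalChange : ℚ) / (r : ℚ)⌉₊ + ∑ j : Fin n, (g.monoDes j + m j.succ) ∧
      ∀ j : Fin n, g.sortedCoord s j = g.sortedCoord s ((j : ℕ) + 1) +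
        (g.colorChange j + r * (g.monoDes j + m j.succ)) := by
  rw [← eq_sum_tail_iff _ (fun j => g.colorChange j + r * (g.monoDes j + m j.succ))
    (g.sortedCoord_of_le s le_rfl), Finsupp.ext_iff, Fin.forall_fin_succ, coneExp_zero,
    ← g.perm.forall_congr_right]
  refine and_congr_right fun _ => ⟨fun H k hk => ?_, fun H i => ?_⟩
  · rcases hk.lt_or_eq with hk | rfl
    · rw [← coneExp_succ g m ⟨k, hk⟩, ← H]
      exact g.sortedCoord_of_lt s ⟨k, hk⟩
    · rw [sortedCoord_of_le _ _ le_rfl]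
      exact (Finset.sum_eq_zero fun j _ => if_neg (by omega)).symm
  · rw [coneExp_succ, ← H i i.2.le, sortedCoord_of_lt]

theorem coneExp_injective [NeZero r] (g : ColoredPerm r n) : Function.Injective g.coneExp := by
  intro m m' h
  obtain ⟨h0, hs⟩ := (g.eq_coneExp_iff _ m).1 rfl
  obtain ⟨h0', hs'⟩ := (g.eq_coneExp_iff _ m').1 h
  have hsucc (j : Fin n) : m j.succ = m' j.succ := by
    have := (hs j).symm.trans (hs' j)
    have := Nat.eq_of_mul_eq_mul_left (NeZero.pos r)
      (Nat.add_left_cancel (Nat.add_left_cancel this))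
    omega
  have := h0.symm.trans h0'
  simp only [hsucc] at this
  funext j
  refine Fin.cases ?_ hsucc j
  omega

/-! ### The cones partition the lattice points -/

theorem monoDes_eq_zero_or (g : ColoredPerm r n) (j : Fin n) :
    g.monoDes j = 0 ∨ g.monoDes j = 1 ∧ j ∈ permDes g.perm ∧ g.colorChange j = 0 := by
  by_cases h : j ∈ permDes g.perm ∧ g.colorChange j = 0
  · exact Or.inr ⟨if_pos h, h⟩
  · exact Or.inl (if_neg h)

theorem ceil_totalChange_div_le_iff [NeZero r] (g : ColoredPerm r n) (N : ℕ) :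
    ⌈(g.totalChange : ℚ) / (r : ℚ)⌉₊ ≤ N ↔ g.totalChange ≤ r * N := by
  have hr : (0 : ℚ) < r := by exact_mod_cast NeZero.pos r
  rw [Nat.ceil_le, div_le_iff₀ hr, mul_comm]
  exact_mod_cast Iff.rfl

/-- If the differences of the sorted coordinates are `a_j + r * q_j`, then the largest coordinate
is at most `r * N` if and only if `⌈ch(ε) / r⌉ + ∑ j, q_j` is at most `N`. -/
theorem sortedCoord_zero_le_iff [NeZero r] (g : ColoredPerm r n) {s : Fin (n + 1) →₀ ℕ}
    {q : Fin n → ℕ}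
    (h : ∀ j : Fin n, g.sortedCoord s j = g.sortedCoord s ((j : ℕ) + 1) +
      (g.colorChange j + r * q j)) (N : ℕ) :
    g.sortedCoord s 0 ≤ r * N ↔ ⌈(g.totalChange : ℚ) / (r : ℚ)⌉₊ + ∑ j, q j ≤ N := by
  have h0 := (eq_sum_tail_iff _ _ (g.sortedCoord_of_le s le_rfl)).2 h 0 n.zero_le
  simp only [Nat.zero_le, if_true, Finset.sum_add_distrib, ← Finset.mul_sum] at h0
  rw [h0]
  change g.totalChange + r * _ ≤ _ ↔ _
  constructor
  · intro H
    have hq : ∑ j, q j ≤ N := Nat.le_of_mul_le_mul_left (by omega) (NeZero.pos r)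
    obtain ⟨M, rfl⟩ := exists_add_of_le hq
    have := (g.ceil_totalChange_div_le_iff M).2 (by rw [mul_add] at H; omega)
    omega
  · intro H
    obtain ⟨M, rfl⟩ := exists_add_of_le H
    have := (g.ceil_totalChange_div_le_iff _).1 le_rfl
    rw [mul_add, mul_add]
    omega

/-- The exponent vectors of the terms of the series of `(π, ε)`: they are sorted by `π`, have
the colors as their residues modulo `r`, and their largest coordinate is at most `r * s 0`. -/
theorem mem_range_coneExp_iff [NeZero r] (g : ColoredPerm r n) (s : Fin (n + 1) →₀ ℕ) :
    s ∈ Set.range g.coneExp ↔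
      (∀ j : Fin n, s j.succ ≤ r * s 0) ∧
      g.perm = Tuple.sort (fun j : Fin n => OrderDual.toDual (s j.succ)) ∧
      ∀ j : Fin n, g.color j = (s (g.perm j).succ : ZMod r) := by
  have hr := NeZero.pos r
  have hy (j : Fin n) : g.sortedCoord s j = s (g.perm j).succ := g.sortedCoord_of_lt s j
  have hy' (j : Fin n) (h : (j : ℕ) + 1 < n) :
      g.sortedCoord s ((j : ℕ) + 1) = s (g.perm ⟨(j : ℕ) + 1, h⟩).succ :=
    g.sortedCoord_of_lt s ⟨(j : ℕ) + 1, h⟩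
  rw [eq_sort_iff_forall_succ]
  simp only [OrderDual.toDual_le_toDual, OrderDual.toDual_lt_toDual]
  constructor
  · rintro ⟨m, hm⟩
    obtain ⟨h0, hs⟩ := (g.eq_coneExp_iff s m).1 hm.symm
    refine ⟨?_, fun j h => ⟨?_, fun hdes => ?_⟩, fun j => ?_⟩
    · -- Every coordinate is a tail sum of the differences, so the first one is the largest.
      have hmax := (g.sortedCoord_zero_le_iff hs (s 0)).2 (by omega)
      rw [← g.perm.forall_congr_right]
      intro i
      have htail := (eq_sum_tail_iff _ _ (g.sortedCoord_of_le s le_rfl)).2 hs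
      refine le_trans ?_ hmax
      rw [← hy, htail i i.2.le, htail 0 n.zero_le]
      refine Finset.sum_le_sum fun j _ => ?_
      split_ifs <;> simp_all
    · rw [← hy j, ← hy' j h, hs j]
      exact Nat.le_add_right _ _
    · rw [← hy j, ← hy' j h, hs j]
      have hj : j ∈ permDes g.perm := by simpa [permDes] using ⟨h, hdes⟩
      have hpos : 0 < g.colorChange j + r * (g.monoDes j + m j.succ) := by
        by_cases ha : g.colorChange j = 0
        · have : g.monoDes j = 1 := if_pos ⟨hj, ha⟩
          rw [this]
          positivity
        · omega
      omega
    · -- The differences are `a_j` modulo `r`, so the residues telescope down from `c_{n+1} = 0`.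
      have hcol (k : ℕ) (hk : k ≤ n) : (g.sortedCoord s k : ZMod r) = g.colorExt k := by
        induction hk using Nat.decreasingInduction with
        | self => simp [sortedCoord, colorExt]
        | of_succ k hk ih =>
          rw [hs ⟨k, hk⟩]
          push_cast
          rw [ih, colorChange, ZMod.natCast_zmod_val]
          simp
      rw [← hy, hcol j j.2.le]
      simp [colorExt]
  · rintro ⟨hmax, hsort, hcol⟩
    have hanti (j : Fin n) : g.sortedCoord s ((j : ℕ) + 1) ≤ g.sortedCoord s j := by
      by_cases h : (j : ℕ) + 1 < n
      · rw [hy, hy' j h]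
        exact (hsort j h).1
      · rw [g.sortedCoord_of_le s (by omega)]
        exact Nat.zero_le _
    have hcol' (k : ℕ) : (g.sortedCoord s k : ZMod r) = g.colorExt k := by
      unfold sortedCoord colorExt
      split_ifs with h
      · exact (hcol ⟨k, h⟩).symm
      · simp
    choose d hd using fun j => exists_add_of_le (hanti j)
    have hmod (j : Fin n) : d j % r = g.colorChange j := by
      rw [colorChange, ← hcol', ← hcol', hd j, ← ZMod.val_natCast]
      push_cast
      rw [add_sub_cancel_left]
    have hq (j : Fin n) : g.monoDes j ≤ d j / r := by
      rcases g.monoDes_eq_zero_or j with h | ⟨h, hj, ha⟩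
      · exact h ▸ Nat.zero_le _
      · simp only [permDes, Finset.mem_filter, Finset.mem_univ, true_and] at hj
        obtain ⟨hn, hlt⟩ := hj
        have hpos : 0 < d j := by
          have := (hsort j hn).2 hlt
          rw [← hy j, ← hy' j hn, hd j] at this
          omega
        rw [h]
        exact Nat.div_pos (Nat.le_of_dvd hpos (Nat.dvd_of_mod_eq_zero ((hmod j).trans ha))) hr
    have hs (j : Fin n) : g.sortedCoord s j = g.sortedCoord s ((j : ℕ) + 1) +
        (g.colorChange j + r * (d j / r)) := by
      rw [← hmod, Nat.mod_add_div, ← hd]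
    have hmax' : g.sortedCoord s 0 ≤ r * s 0 := by
      unfold sortedCoord
      split_ifs
      · exact hmax _
      · exact Nat.zero_le _
    have hle := (g.sortedCoord_zero_le_iff hs (s 0)).1 hmax'
    -- `a_j` is the remainder of the `j`-th difference, so its quotient by `r`, less the ray already
    -- in the numerator, is the multiplicity of the `j`-th ray; `m 0` takes up the slack in `s 0`.
    refine ⟨Fin.cons (s 0 - (⌈(g.totalChange : ℚ) / (r : ℚ)⌉₊ + ∑ j, d j / r))
      (fun j => d j / r - g.monoDes j), Eq.symm ?_⟩
    rw [eq_coneExp_iff]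
    simp only [Fin.cons_zero, Fin.cons_succ, Nat.add_sub_cancel' (hq _)]
    exact ⟨by omega, hs⟩

end ColoredPerm

/-! ### The identity -/

theorem theorem5p11 (r n : ℕ) [NeZero r] (R : Type*) [CommRing R] [TopologicalSpace R] :
    (∀ g : ColoredPerm r n, IsUnit (g.denom R)) ∧
    HasSum
      (fun k : ℕ =>
        (∏ j : Fin n,
          qInt (r * k + 1) (MvPowerSeries.X j.succ : MvPowerSeries (Fin (n + 1)) R)) *
          MvPowerSeries.X 0 ^ k)
      (∑ g : ColoredPerm r n, g.numer R * Ring.inverse (g.denom R)) := by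
  classical
  refine ⟨ColoredPerm.isUnit_denom R, ?_⟩
  have hterm (g : ColoredPerm r n) :
      g.numer R * Ring.inverse (g.denom R) = indicatorSeries R (Set.range g.coneExp) := by
    rw [eq_comm, Ring.eq_mul_inverse_iff_mul_eq _ _ _ (g.isUnit_denom R),
      g.denom_eq_prod R, g.numer_eq_monomial R]
    exact indicatorSeries_range_mul_prod R g.numerExp (fun j : Fin (n + 1) => g.rayExp j)
      g.coneExp_injective
  have hsum : ∑ g : ColoredPerm r n, g.numer R * Ring.inverse (g.denom R) =
      indicatorSeries R {s : Fin (n + 1) →₀ ℕ | ∀ j : Fin n, s j.succ ≤ r * s 0} := by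
    ext s
    simp only [hterm, map_sum, coeff_indicatorSeries, Set.mem_ofPred_eq,
      ColoredPerm.mem_range_coneExp_iff]
    by_cases hs : ∀ j : Fin n, s j.succ ≤ r * s 0
    · set π := Tuple.sort (fun j : Fin n => OrderDual.toDual (s j.succ)) with hπ
      have hg (g : ColoredPerm r n) :
          (g.perm = π ∧ ∀ j : Fin n, g.color j = (s (g.perm j).succ : ZMod r)) ↔
            g = ⟨π, fun j => (s (π j).succ : ZMod r)⟩ := by
        rw [ColoredPerm.ext_iff]
        exact and_congr_right fun h => by rw [funext_iff, h]
      simp [hs, hg]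
    · simp [hs]
  rw [hsum]
  convert hasSum_indicatorSeries_slices (R := R)
    {s : Fin (n + 1) →₀ ℕ | ∀ j : Fin n, s j.succ ≤ r * s 0} 0 using 2 with k
  rw [prod_qInt_mul_X_pow]
  congr 1
  ext s
  exact and_congr_left fun h => by rw [Set.mem_ofPred_eq, h]
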